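/- **Draft auction.** There are $m \ge 2$ items $[m]$ and a nonempty finite set of $n$ bidders with a fixed (strict, total) tie-breaking order. Bidder $i$ has a valuation $v_i : 2^{[m]} \to \mathbb{R}_{\ge 0}$ that is monotone, and utility $v_i(S) - p$ for receiving bundle $S$ and paying $p$ in total. The auction proceeds in rounds as long as items remain. In each round every bidder submits a sealed bid together with a nonempty set $X_i$ of remaining items. A bid is either a number $b \in [0,\infty)$ or "$b+$" for such a $b$, which beats $b$, loses to every number larger than $b$, and has price $b$. The highest bidder wins the round (ties are broken by the fixed order), receives the set $X_i$ that she named, and pays the price of her bid for each item in it; the winner, her bid and her bundle are announced. A strategy of a bidder is a function from announced histories to actions; $B_i$ is the set of strategies of bidder $i$. For a strategy profile $b$, let $P_i(b)$ be the total payment of bidder $i$, and $u_i(b; v_i)$ her utility in the resulting play. **Smoothness.** A mechanism is $(\lambda,\mu)$-smooth for a class $V$ of valuations if for every valuation profile $v = (v_i)_i$ with all $v_i \in V$ there are deviation mappings $b_i' : B_i \to B_i$, one for each bidder $i$, such that for every strategy profile $b$ $$\sum_i u_i\big(b_i'(b_i), b_{-i}; v_i\big) \;\ge\; \lambda\, \mathrm{OPT}(v)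 - \mu \sum_i P_i(b),$$ where $\mathrm{OPT}(v)$ is the maximum of $\sum_i v_i(A_i)$ over all families $(A_i)_i$ of pairwise disjoint subsets of $[m]$. **Classes.** A monotone nonnegative valuation $v$ is *XOS* if there are finitely many ($k \ge 1$) linear functions with $v(S) = \max_{1 \le l \le k} \sum_{j \in S} v_{lj}$ for all $S$, and *subadditive* if $v(S \cup T) \le v(S) + v(T)$ for all $S, T \subseteq [m]$. **Corollary.** Let $\log$ denote the natural logarithm and $H_m = \sum_{k=1}^m 1/k$. The draft auction is $$\Big(\frac{1}{8(\log(m-1)+1)},\, 2\Big)\text{-smooth for XOS valuations, and}\quad \Big(\frac{1}{8 H_m(\log(m-1)+1)},\, 2\Big)\text{-smooth for subadditive valuations.}$$ (Since $\ln x \le \log_2 x$ for $x \ge 1$ and a larger $\lambda$ is a stronger claim, the same holds a fortiori with $\log = \log_2$.) -/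

import Mathlib

open Finset
open scoped NNReal

noncomputable section

namespace DraftAuction

/-! ### Combinatorial auctions, welfare and smooth mechanisms -/

/-- A mechanism for selling the items `I` to the bidders `N`: a strategy space for every bidder,
and, for every strategy profile, the bundle that each bidder receives and what she pays. -/
structure Mechanism (N I : Type*) where
  Strategy : N → Type*
  alloc : (∀ i, Strategy i) → N → Finset I
  payment : (∀ i, Strategy i) → N → ℝ

/-- Quasilinear utility of bidder `i` with valuation `w` under the strategy profile `b`. -/
def Mechanism.utility {N I : Type*} (M : Mechanism N I) (b : ∀ i, M.Strategy i) (i : N)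
    (w : Finset I → ℝ) : ℝ :=
  w (M.alloc b i) - M.payment b i

/-- The optimal social welfare: the maximum of `∑ i, v i (A i)` over all allocations `A` of
pairwise disjoint bundles. -/
def optWelfare {N I : Type*} [Fintype N] (v : N → Finset I → ℝ) : ℝ :=
  ⨆ A : {A : N → Finset I // ∀ i j, i ≠ j → Disjoint (A i) (A j)}, ∑ i, v i (A.1 i)

/-- A mechanism is `(lam, mu)`-smooth for the valuation class `V` if for every profile `v` of
valuations in `V` there are deviation mappings, one for each bidder `i`, taking the strategy of `i`
alone to another strategy of `i`, such that for every strategy profile `b` the unilateral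
deviations have total utility at least `lam * OPT(v) - mu * revenue(b)`. -/
def IsSmooth {N I : Type*} [Fintype N] [DecidableEq N] (M : Mechanism N I)
    (V : Set (Finset I → ℝ)) (lam mu : ℝ) : Prop :=
  ∀ v : N → Finset I → ℝ, (∀ i, v i ∈ V) →
    ∃ dev : ∀ i, M.Strategy i → M.Strategy i, ∀ b : ∀ i, M.Strategy i,
      lam * optWelfare v - mu * ∑ i, M.payment b i ≤
        ∑ i, M.utility (Function.update b i (dev i (b i))) i (v i)

/-! ### Valuation classes -/

/-- A valuation is a nonnegative monotone set function. -/
def IsValuation {I : Type*} (w : Finset I → ℝ) : Prop :=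
  (∀ S, 0 ≤ w S) ∧ Monotone w

/-- XOS valuations: maxima of finitely many linear functions. -/
def xos (I : Type*) : Set (Finset I → ℝ) :=
  {w | IsValuation w ∧ ∃ (k : ℕ) (a : Fin (k + 1) → I → ℝ),
    ∀ S, w S = univ.sup' univ_nonempty (fun l => ∑ j ∈ S, a l j)}

/-- Subadditive (complement-free) valuations. -/
def subadditive (I : Type*) [DecidableEq I] : Set (Finset I → ℝ) :=
  {w | IsValuation w ∧ ∀ S T, w (S ∪ T) ≤ w S + w T}

/-! ### The draft auction -/

/-- A bid is either a plain bid `b`, encoded as `(b, false)`, or the bid `b+`, encoded as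
`(b, true)`, which beats `b` and loses to every plain bid above `b`.  The order is lexicographic. -/
abbrev Bid : Type := ℝ≥0 ×ₗ Bool

/-- The price per item that is paid for a bid: `b` for both `b` and `b+`. -/
def Bid.price (x : Bid) : ℝ := ((ofLex x).1 : ℝ)

/-- What is announced after a round: the winner, the winning bid and the bundle she takes. -/
structure Round (N : Type*) (m : ℕ) where
  winner : N
  bid : Bid
  bundle : Finset (Fin m)

/-- The items not yet sold after the rounds in `h`. -/
def remaining {N : Type*} {m : ℕ} (h : List (Round N m)) : Finset (Fin m) :=
  univ.filter fun j => ∀ r ∈ h, j ∉ r.bundle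

/-- A strategy chooses, after each public history, a bid and a bundle to demand.  As long as items
remain, the bundle has to be a nonempty set of remaining items. -/
def Strategy (N : Type*) (m : ℕ) : Type _ :=
  {s : List (Round N m) → Bid × Finset (Fin m) //
    ∀ h, (remaining h).Nonempty → (s h).2.Nonempty ∧ (s h).2 ⊆ remaining h}

theorem exists_highest {N : Type*} [Fintype N] [Nonempty N] (x : N → Bid) :
    (univ.filter fun i => ∀ j, x j ≤ x i).Nonempty := by
  obtain ⟨i, -, hi⟩ := Finset.exists_max_image univ x univ_nonempty
  exact ⟨i, by simpa using hi⟩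

section Play

variable {N : Type*} [Fintype N] [LinearOrder N] [Nonempty N] {m : ℕ}

/-- The highest bidder; ties are broken by the fixed order of the bidders. -/
def winner (x : N → Bid) : N :=
  (univ.filter fun i => ∀ j, x j ≤ x i).min' (exists_highest x)

/-- The round that is played after the history `h` under the profile `b`. -/
def nextRound (b : N → Strategy N m) (h : List (Round N m)) : Round N m :=
  let i := winner fun k => ((b k).1 h).1
  { winner := i, bid := ((b i).1 h).1, bundle := ((b i).1 h).2 }

/-- The history after (at most) `t` rounds; play stops when all items are sold. -/
def play (b : N → Strategy N m) : ℕ → List (Round N m)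
  | 0 => []
  | t + 1 => if remaining (play b t) = ∅ then play b t
      else play b t ++ [nextRound b (play b t)]

/-- The history when the auction ends.  Every round sells at least one item, so `m` rounds
always suffice. -/
def finalHistory (b : N → Strategy N m) : List (Round N m) := play b m

/-- The items won by `i` in the rounds of `h`. -/
def wonItems (h : List (Round N m)) (i : N) : Finset (Fin m) :=
  univ.filter fun j => ∃ r ∈ h, r.winner = i ∧ j ∈ r.bundle

/-- The total payment of `i` in the rounds of `h`: in every round that she wins, her bid for each
item that she takes. -/
def totalPayment (h : List (Round N m)) (i : N) : ℝ :=
  ((h.filter fun r => r.winner = i).map fun r => r.bid.price * (r.bundle.card : ℝ)).sum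

theorem card_remaining_play (b : N → Strategy N m) (t : ℕ) :
    (remaining (play b t)).card ≤ m - t := by
  induction t with
  | zero => exact (card_le_univ _).trans (by simp)
  | succ t ih =>
    by_cases h : remaining (play b t) = ∅
    · simp [play, h]
    · obtain ⟨⟨j, hj⟩, hsub⟩ :=
        (b (winner fun k => ((b k).1 (play b t)).1)).2 _ (nonempty_iff_ne_empty.2 h)
      have hlt : remaining (play b (t + 1)) ⊂ remaining (play b t) := by
        rw [play, if_neg h]
        refine ssubset_iff_of_subset (fun x hx => ?_) |>.2 ⟨j, hsub hj, ?_⟩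
        · simp only [remaining, mem_filter, mem_univ, true_and, List.mem_append] at hx ⊢
          exact fun r hr => hx r (Or.inl hr)
        · simp only [remaining, mem_filter, mem_univ, true_and, not_forall, not_not]
          exact ⟨nextRound b (play b t), by simp, hj⟩
      have := card_lt_card hlt
      omega

/-- All items are sold when the auction ends. -/
theorem remaining_finalHistory (b : N → Strategy N m) : remaining (finalHistory b) = ∅ := by
  have := card_remaining_play b m
  exact card_eq_zero.1 (by unfold finalHistory; omega)

end Play

/-- The sequential draft auction of `m` items among the bidders `N`. -/
def draftAuction (N : Type*) [Fintype N] [LinearOrder N] [Nonempty N] (m : ℕ) :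
    Mechanism N (Fin m) where
  Strategy := fun _ => Strategy N m
  alloc := fun b => wonItems (finalHistory b)
  payment := fun b => totalPayment (finalHistory b)

end DraftAuction

end

namespace DraftAuction

/-! Both claims follow from the stronger bound `isSmooth_subadditive`, with factor `1 / (2 H_m)`:
XOS valuations are subadditive, and `H_m ≤ 4 (log (m - 1) + 1)`.

By `exists_uniform_lower_bound`, a subadditive bidder has inside her optimal bundle a target `T` and
a price `q` with `v U ≥ q |U|` for all `U ⊆ T`, where `q |T|` is at least a `1 / H_m` fraction of
the value of the bundle. She deviates by bidding at least `q / 2` while items of `T` remain, keeping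
her original action whenever it already bids that much. Play is then unchanged until she wins a
round with the raised bid and takes what is left of `T`, or until `T` is sold out. Every item of `T`
lost before that was sold at `q / 2` or more in the original play too, so the shortfall is charged
to the original revenue from `T`; purchases made before that are charged to her own original
payment. This is `utility_targetStrategy`. Summed over bidders, each charge is at most the total
revenue, as the targets are disjoint, whence the factor 2. -/

/-- The total price paid in the rounds of `h` for items of `T`. -/
noncomputable def itemRevenue {N : Type*} {m : ℕ} (h : List (Round N m)) (T : Finset (Fin m)) : ℝ :=
  (h.map fun r => r.bid.price * ((r.bundle ∩ T).card : ℝ)).sum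

theorem Bid.price_nonneg (x : Bid) : 0 ≤ x.price := (ofLex x).1.2

theorem Bid.le_price {p : ℝ≥0} {x : Bid} (h : toLex (p, false) ≤ x) : (p : ℝ) ≤ x.price := by
  rcases (Prod.Lex.le_iff).1 h with h | h
  · exact_mod_cast h.le
  · exact_mod_cast h.1.le

/-! ### Uniform lower bounds for subadditive valuations -/

/-- Each of the `b` additional terms is at least `1 / (a + b)`. -/
theorem harmonic_add_div_le (a b : ℕ) (hb : 0 < b) :
    (harmonic a : ℝ) + b / ((a + b : ℕ) : ℝ) ≤ harmonic (a + b) := by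
  have hab : (0 : ℝ) < ((a + b : ℕ) : ℝ) := by exact_mod_cast (by omega : 0 < a + b)
  unfold harmonic
  rw [Finset.sum_range_add]
  push_cast
  gcongr
  have h := Finset.card_nsmul_le_sum (range b) (fun k => ((a : ℝ) + k + 1)⁻¹)
    (((a + b : ℕ) : ℝ)⁻¹) (fun k hk => by
      have hk' : k + 1 ≤ b := by simpa using hk
      have : (k : ℝ) + 1 ≤ b := by exact_mod_cast hk'
      push_cast
      gcongr ?_⁻¹
      linarith)
  simpa [div_eq_mul_inv] using h

theorem harmonic_mono {a b : ℕ} (hab : a ≤ b) : (harmonic a : ℝ) ≤ harmonic b := by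
  unfold harmonic
  push_cast
  exact Finset.sum_le_sum_of_subset_of_nonneg (range_mono hab) fun _ _ _ => by positivity

theorem one_le_harmonic {a : ℕ} (ha : 1 ≤ a) : (1 : ℝ) ≤ harmonic a := by
  simpa [harmonic] using harmonic_mono ha

/-- Remove a subset `U` of least average value `d` and recurse on `S \ U`. Minimality makes `d` a
uniform price on all of `S`, so both `S` at price `d` and the recursive target are candidates; the
one of larger total price is kept. -/
theorem exists_uniform_lower_bound {I : Type*} [DecidableEq I] {v : Finset I → ℝ}
    (hv : v ∈ subadditive I) (S : Finset I) (hS : S.Nonempty) :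
    ∃ T ⊆ S, ∃ p : ℝ≥0, (∀ U ⊆ T, (p : ℝ) * U.card ≤ v U) ∧
      v S ≤ p * T.card * harmonic S.card := by
  induction S using Finset.strongInduction with
  | H S ih =>
    obtain ⟨U, hU, hmin⟩ := Finset.exists_min_image (S.powerset.filter Finset.Nonempty)
      (fun U => v U / U.card) ⟨S, by simpa using hS⟩
    simp only [mem_filter, mem_powerset, and_imp] at hU hmin
    obtain ⟨hUS, hUne⟩ := hU
    have hUc : (0 : ℝ) < U.card := by exact_mod_cast hUne.card_pos
    have hSc : (0 : ℝ) < S.card := by exact_mod_cast hS.card_pos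
    obtain ⟨d, hd⟩ : ∃ d : ℝ≥0, (d : ℝ) = v U / U.card :=
      ⟨⟨v U / U.card, div_nonneg (hv.1.1 _) hUc.le⟩, rfl⟩
    have hvU : v U = d * U.card := by rw [hd, div_mul_cancel₀ _ hUc.ne']
    have hdS : ∀ W ⊆ S, (d : ℝ) * W.card ≤ v W := by
      intro W hW
      rcases W.eq_empty_or_nonempty with rfl | hne
      · simpa using hv.1.1 ∅
      · have := hmin W hW hne
        rwa [← hd, le_div_iff₀ (by exact_mod_cast hne.card_pos)] at this
    have hH : (1 : ℝ) ≤ harmonic S.card := one_le_harmonic hS.card_pos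
    rcases (S \ U).eq_empty_or_nonempty with hE | hE
    · obtain rfl : U = S := hUS.antisymm (sdiff_eq_empty_iff_subset.1 hE)
      refine ⟨U, Subset.rfl, d, hdS, ?_⟩
      rw [hvU]
      exact le_mul_of_one_le_right (mul_nonneg d.2 hUc.le) hH
    · obtain ⟨T, hT, p, hp, hle⟩ := ih (S \ U) (sdiff_ssubset hUS hUne) hE
      have hcard : (S \ U).card + U.card = S.card := card_sdiff_add_card_eq_card hUS
      have hharm := harmonic_add_div_le (S \ U).card U.card hUne.card_pos
      rw [hcard] at hharm
      have hH' : (0 : ℝ) ≤ harmonic (S \ U).card :=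
        zero_le_one.trans (one_le_harmonic hE.card_pos)
      -- `M` stands for the larger of the two total prices. Removing `U` costs `d |U|`, at most `M
      -- |U| / |S|`, which the harmonic increment absorbs.
      have hbound : ∀ M : ℝ, (d : ℝ) * S.card ≤ M → (p : ℝ) * T.card ≤ M →
          v S ≤ M * harmonic S.card := by
        intro M h1 h2
        have hM : 0 ≤ M := (mul_nonneg d.2 hSc.le).trans h1
        calc v S = v (U ∪ S \ U) := by rw [union_sdiff_of_subset hUS]
          _ ≤ v U + v (S \ U) := hv.2 _ _
          _ ≤ d * S.card * (U.card / S.card) + p * T.card * harmonic (S \ U).card := by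
              refine add_le_add (le_of_eq ?_) hle
              rw [hvU, mul_assoc, mul_div_cancel₀ _ hSc.ne']
          _ ≤ M * (U.card / S.card) + M * harmonic (S \ U).card :=
              add_le_add (mul_le_mul_of_nonneg_right h1 (div_nonneg hUc.le hSc.le))
                (mul_le_mul_of_nonneg_right h2 hH')
          _ = M * (harmonic (S \ U).card + U.card / S.card) := by ring
          _ ≤ M * harmonic S.card := mul_le_mul_of_nonneg_left hharm hM
      rcases le_total ((d : ℝ) * S.card) (p * T.card) with h | h
      · exact ⟨T, hT.trans sdiff_subset, p, hp, hbound _ h le_rfl⟩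
      · exact ⟨S, Subset.rfl, d, hdS, hbound _ le_rfl h⟩

/-- A target bundle and a reserve price which guarantee at least a `1 / (2 H_m)` fraction of the
value of `S`, whichever part `U` of the target is still available when the price is offered. -/
theorem exists_target {m : ℕ} (hm : 1 ≤ m) {v : Finset (Fin m) → ℝ}
    (hv : v ∈ subadditive (Fin m)) (S : Finset (Fin m)) :
    ∃ T ⊆ S, ∃ (p : ℝ≥0) (g : ℝ), (∀ U ⊆ T, g + 2 * p * U.card ≤ v U + p * T.card) ∧
      v S ≤ 2 * harmonic m * g := by
  have hH : (1 : ℝ) ≤ harmonic m := one_le_harmonic hm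
  rcases S.eq_empty_or_nonempty with rfl | hS
  · refine ⟨∅, Subset.rfl, 0, v ∅, ?_, ?_⟩
    · intro U hU
      simp [subset_empty.1 hU]
    · have := hv.1.1 ∅
      nlinarith
  -- Half the uniform price: an item of `T` then yields surplus `p / 2` if bought and costs someone
  -- at least `p / 2` if lost.
  · obtain ⟨T, hT, p, hp, hle⟩ := exists_uniform_lower_bound hv S hS
    refine ⟨T, hT, p / 2, p * T.card / 2, fun U hU => ?_, ?_⟩
    · have := hp U hU
      push_cast
      linarith
    · have h1 : (harmonic S.card : ℝ) ≤ harmonic m :=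
        harmonic_mono (by simpa using card_le_univ S)
      calc v S ≤ p * T.card * harmonic S.card := hle
        _ ≤ p * T.card * harmonic m := by gcongr
        _ = _ := by ring

/-- Split the maximizing linear function over `S` and `T \ S`; monotonicity replaces `T \ S` by `T`,
since coefficients may be negative. -/
theorem xos_subset_subadditive (I : Type*) [DecidableEq I] : xos I ⊆ subadditive I := by
  rintro w ⟨hw, k, a, ha⟩
  refine ⟨hw, fun S T => ?_⟩
  have key : ∀ l S, ∑ j ∈ S, a l j ≤ w S := fun l S => by
    rw [ha]; exact Finset.le_sup' (fun l => ∑ j ∈ S, a l j) (mem_univ l)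
  rw [ha (S ∪ T)]
  refine Finset.sup'_le _ _ fun l _ => ?_
  rw [← union_sdiff_self_eq_union, sum_union disjoint_sdiff]
  exact add_le_add (key l S) ((key l _).trans (hw.2 sdiff_subset))

/-! ### Histories -/

section Histories

variable {N : Type*} {m : ℕ}

theorem itemRevenue_nonneg (h : List (Round N m)) (T : Finset (Fin m)) : 0 ≤ itemRevenue h T := by
  refine List.sum_nonneg fun x hx => ?_
  obtain ⟨r, -, rfl⟩ := List.mem_map.1 hx
  exact mul_nonneg r.bid.price_nonneg (Nat.cast_nonneg _)

theorem itemRevenue_le_of_prefix {h h' : List (Round N m)} (hp : h <+: h') (T : Finset (Fin m)) :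
    itemRevenue h T ≤ itemRevenue h' T := by
  obtain ⟨l, rfl⟩ := hp
  have := itemRevenue_nonneg l T
  simp only [itemRevenue, List.map_append, List.sum_append] at this ⊢
  linarith

/-- Every missing item of `T` lies in the bundle of some round, where it was charged at least `p`.
-/
theorem mul_card_sdiff_remaining_le {p : ℝ≥0} (T : Finset (Fin m)) (h : List (Round N m))
    (hh : ∀ r ∈ h, (p : ℝ) ≤ r.bid.price) :
    (p : ℝ) * (T \ remaining h).card ≤ itemRevenue h T := by
  induction h with
  | nil => simp [remaining, itemRevenue, sdiff_eq_empty_iff_subset.2 (subset_univ T)]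
  | cons r h ih =>
    have ih := ih fun r' hr' => hh r' (List.mem_cons_of_mem _ hr')
    have hsub : T \ remaining (r :: h) ⊆ (r.bundle ∩ T) ∪ (T \ remaining h) := by
      intro j hj
      simp only [remaining, mem_sdiff, mem_filter, mem_univ, true_and, mem_union, mem_inter,
        List.forall_mem_cons] at hj ⊢
      tauto
    have hc : ((T \ remaining (r :: h)).card : ℝ) ≤
        (r.bundle ∩ T).card + (T \ remaining h).card := by
      exact_mod_cast (card_le_card hsub).trans (card_union_le _ _)
    have hr := hh r List.mem_cons_self
    have e : itemRevenue (r :: h) T = r.bid.price * (r.bundle ∩ T).card + itemRevenue h T := by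
      simp only [itemRevenue, List.map_cons, List.sum_cons]
    rw [e]
    calc (p : ℝ) * (T \ remaining (r :: h)).card
        ≤ p * ((r.bundle ∩ T).card + (T \ remaining h).card) := by gcongr
      _ = p * (r.bundle ∩ T).card + p * (T \ remaining h).card := by ring
      _ ≤ _ := by gcongr

variable [LinearOrder N]

theorem totalPayment_nonneg [Fintype N] [Nonempty N] (h : List (Round N m)) (i : N) :
    0 ≤ totalPayment h i := by
  refine List.sum_nonneg fun x hx => ?_
  obtain ⟨r, -, rfl⟩ := List.mem_map.1 hx
  exact mul_nonneg r.bid.price_nonneg (Nat.cast_nonneg _)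

theorem totalPayment_append [Fintype N] [Nonempty N] (h h' : List (Round N m)) (i : N) :
    totalPayment (h ++ h') i = totalPayment h i + totalPayment h' i := by
  simp [totalPayment]

theorem totalPayment_singleton [Fintype N] [Nonempty N] (r : Round N m) (i : N) :
    totalPayment [r] i = if r.winner = i then r.bid.price * r.bundle.card else 0 := by
  by_cases h : r.winner = i <;> simp [totalPayment, h]

theorem totalPayment_le_of_prefix [Fintype N] [Nonempty N] {h h' : List (Round N m)}
    (hp : h <+: h') (i : N) : totalPayment h i ≤ totalPayment h' i := by
  obtain ⟨l, rfl⟩ := hp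
  rw [totalPayment_append]
  exact le_add_of_nonneg_right (totalPayment_nonneg l i)

theorem wonItems_subset_append [Fintype N] [Nonempty N] (h h' : List (Round N m)) (i : N) :
    wonItems h i ⊆ wonItems (h ++ h') i := by
  intro j hj
  simp only [wonItems, mem_filter, mem_univ, true_and, List.mem_append] at hj ⊢
  obtain ⟨r, hr, h⟩ := hj
  exact ⟨r, Or.inl hr, h⟩

/-- Disjoint bundles raise at most the whole revenue. -/
theorem sum_itemRevenue_le [Fintype N] [Nonempty N] (h : List (Round N m))
    (T : N → Finset (Fin m)) (hT : ∀ i j, i ≠ j → Disjoint (T i) (T j)) :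
    ∑ i, itemRevenue h (T i) ≤ ∑ i, totalPayment h i := by
  induction h with
  | nil => simp [itemRevenue, totalPayment]
  | cons r h ih =>
    have e1 : ∀ i, itemRevenue (r :: h) (T i) =
        r.bid.price * (r.bundle ∩ T i).card + itemRevenue h (T i) := fun i => by
      simp only [itemRevenue, List.map_cons, List.sum_cons]
    have e2 : ∀ i, totalPayment (r :: h) i =
        (if r.winner = i then r.bid.price * r.bundle.card else 0) + totalPayment h i := fun i => by
      rw [← totalPayment_singleton, ← totalPayment_append, List.singleton_append]
    simp only [e1, e2, sum_add_distrib, ← mul_sum, sum_ite_eq, mem_univ, if_true]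
    refine add_le_add (mul_le_mul_of_nonneg_left ?_ r.bid.price_nonneg) ih
    rw [← Nat.cast_sum, ← card_biUnion fun i _ j _ hij =>
      (hT i j hij).mono inter_subset_right inter_subset_right]
    exact_mod_cast card_le_card (biUnion_subset.2 fun i _ => inter_subset_left)

variable [Fintype N] [Nonempty N]

theorem play_prefix_succ (b : N → Strategy N m) (t : ℕ) : play b t <+: play b (t + 1) := by
  rw [play]
  split_ifs
  · exact List.prefix_rfl
  · exact List.prefix_append _ _

theorem play_prefix {s t : ℕ} (b : N → Strategy N m) (hst : s ≤ t) : play b s <+: play b t := by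
  induction hst with
  | refl => exact List.prefix_rfl
  | step _ ih => exact ih.trans (play_prefix_succ b _)

/-! ### Rounds -/

theorem le_winner (x : N → Bid) (j : N) : x j ≤ x (winner x) :=
  (mem_filter.1 (min'_mem _ (exists_highest x))).2 j

/-- Lowering the bid of a bidder who does not win does not change the winner. -/
theorem winner_eq_of_le {x y : N → Bid} {i : N} (hxy : ∀ j, j ≠ i → x j = y j) (hi : x i < y i)
    (hw : winner y ≠ i) : winner x = winner y := by
  have hmem : winner y ∈ univ.filter fun k => ∀ j, x j ≤ x k := by
    refine mem_filter.2 ⟨mem_univ _, fun j => ?_⟩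
    rw [hxy _ hw]
    by_cases hj : j = i
    · subst hj; exact hi.le.trans (le_winner y j)
    · rw [hxy j hj]; exact le_winner y j
  refine le_antisymm (min'_le _ _ hmem) (min'_le _ _ ?_)
  have h1 : ∀ j, x j ≤ x (winner x) := le_winner x
  have hne : winner x ≠ i := by
    intro h
    have h2 := h1 (winner y)
    rw [h, hxy _ hw] at h2
    exact absurd (h2.trans_lt hi) (not_lt.2 (le_winner y i))
  refine mem_filter.2 ⟨mem_univ _, fun j => ?_⟩
  rw [← hxy _ hne]
  refine (le_winner y j).trans ?_
  rw [← hxy _ hw]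
  exact h1 _

/-! ### The deviation -/

open scoped Classical in
/-- As long as items of `T` remain, bid at least `p`: follow `s` where it does so, and otherwise
demand the remaining items of `T` at price `p`.  Afterwards bid zero. -/
noncomputable def targetStrategy (T : Finset (Fin m)) (p : ℝ≥0) (s : Strategy N m) :
    Strategy N m :=
  ⟨fun h => if (T ∩ remaining h).Nonempty then
      if toLex (p, false) ≤ (s.1 h).1 then s.1 h else (toLex (p, false), T ∩ remaining h)
    else (toLex (0, false), remaining h), by
    intro h hh
    dsimp only
    split_ifs with h1 h2
    · exact s.2 h hh
    · exact ⟨h1, inter_subset_right⟩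
    · exact ⟨hh, Subset.rfl⟩⟩

/-- Compare the two plays up to the first round in which they differ; `hg` is applied to the part of
`T` still unsold then, or to `∅` if `T` sells out first. -/
theorem utility_targetStrategy {v : Finset (Fin m) → ℝ} (hv : IsValuation v)
    (T : Finset (Fin m)) (p : ℝ≥0) (g : ℝ)
    (hg : ∀ U ⊆ T, g + 2 * p * U.card ≤ v U + p * T.card) (b : N → Strategy N m) (i : N) :
    g - itemRevenue (finalHistory b) T - totalPayment (finalHistory b) i ≤
      v (wonItems (finalHistory (Function.update b i (targetStrategy T p (b i)))) i) -
        totalPayment (finalHistory (Function.update b i (targetStrategy T p (b i)))) i := by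
  set D := Function.update b i (targetStrategy T p (b i)) with hD
  set G := g - itemRevenue (finalHistory b) T - totalPayment (finalHistory b) i with hG
  have hDi : D i = targetStrategy T p (b i) := by simp [hD]
  have hDj : ∀ j, j ≠ i → D j = b j := fun j hj => by simp [hD, hj]
  have hpre : ∀ t ≤ m, (∀ r ∈ play b t, (p : ℝ) ≤ r.bid.price) →
      (p : ℝ) * (T \ remaining (play b t)).card ≤ itemRevenue (finalHistory b) T ∧
        totalPayment (play b t) i ≤ totalPayment (finalHistory b) i := fun t ht h =>
    ⟨(mul_card_sdiff_remaining_le T _ h).trans (itemRevenue_le_of_prefix (play_prefix b ht) T),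
      totalPayment_le_of_prefix (play_prefix b ht) i⟩
  have hdone : ∀ t ≤ m, play D t = play b t → (∀ r ∈ play b t, (p : ℝ) ≤ r.bid.price) →
      ¬ (T ∩ remaining (play D t)).Nonempty →
      G ≤ v (wonItems (play D t) i) - totalPayment (play D t) i := by
    intro t ht he h hT
    obtain ⟨h1, h2⟩ := hpre t ht h
    rw [he, not_nonempty_iff_eq_empty, ← disjoint_iff_inter_eq_empty] at hT
    rw [sdiff_eq_self_of_disjoint hT] at h1
    have h3 := hg ∅ (empty_subset _)
    have h4 := hv.2 (empty_subset (wonItems (play D t) i))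
    simp only [card_empty, Nat.cast_zero, mul_zero, add_zero] at h3
    rw [he] at h4 ⊢
    linarith
  -- Invariant: either the plays agree so far with all prices at least `p`, or `T` is gone and the
  -- utility so far already suffices.
  have key : ∀ t ≤ m, (play D t = play b t ∧ ∀ r ∈ play b t, (p : ℝ) ≤ r.bid.price) ∨
      (¬ (T ∩ remaining (play D t)).Nonempty ∧
        G ≤ v (wonItems (play D t) i) - totalPayment (play D t) i) := by
    intro t
    induction t with
    | zero => intro _; left; simp [play]
    | succ t ih =>
      intro ht
      have ht' : t ≤ m := by omega
      by_cases hR : remaining (play D t) = ∅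
      · have e1 : play D (t + 1) = play D t := by rw [play, if_pos hR]
        rcases ih ht' with ⟨h1, h2⟩ | h
        · left
          have e2 : play b (t + 1) = play b t := by rw [play, if_pos (h1 ▸ hR)]
          rw [e1, e2]; exact ⟨h1, h2⟩
        · right; rw [e1]; exact h
      have e1 : play D (t + 1) = play D t ++ [nextRound D (play D t)] := by rw [play, if_neg hR]
      have hrem : remaining (play D (t + 1)) =
          remaining (play D t) \ (nextRound D (play D t)).bundle := by
        rw [e1]
        ext j
        simp only [remaining, mem_filter, mem_univ, true_and, List.mem_append, mem_sdiff,
          List.mem_singleton]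
        constructor
        · exact fun h => ⟨fun r hr => h r (Or.inl hr), h _ (Or.inr rfl)⟩
        · rintro ⟨h1, h2⟩ r (hr | rfl)
          · exact h1 r hr
          · exact h2
      by_cases hT : (T ∩ remaining (play D t)).Nonempty
      · rcases ih ht' with ⟨he, hb⟩ | h
        swap
        · exact absurd hT h.1
        have e2 : play b (t + 1) = play b t ++ [nextRound b (play b t)] := by
          rw [play, if_neg (he ▸ hR)]
        have hle : toLex (p, false) ≤ ((D i).1 (play D t)).1 := by
          rw [hDi]
          simp only [targetStrategy, if_pos hT]
          split_ifs with h
          · exact h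
          · exact le_rfl
        have hprice : (p : ℝ) ≤ (nextRound D (play D t)).bid.price :=
          Bid.le_price (hle.trans (le_winner (fun k => ((D k).1 (play D t)).1) i))
        by_cases hsame : nextRound D (play D t) = nextRound b (play D t)
        · left
          rw [e1, e2, ← he, hsame]
          refine ⟨rfl, fun r hr => ?_⟩
          rcases List.mem_append.1 hr with hr | hr
          · exact hb r (he ▸ hr)
          · rw [List.mem_singleton.1 hr, ← hsame]; exact hprice
        · right
          -- The rounds differ, so the bid was really raised, and the deviator must have won: a
          -- losing raise leaves the winner unchanged.
          have hlow : ¬ toLex (p, false) ≤ ((b i).1 (play D t)).1 := by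
            intro hlow
            apply hsame
            have hact : ∀ k, (D k).1 (play D t) = (b k).1 (play D t) := by
              intro k
              by_cases hk : k = i
              · subst hk
                rw [hDi]
                simp only [targetStrategy, if_pos hT, if_pos hlow]
              · rw [hDj k hk]
            simp only [nextRound, hact]
          have hactD : (D i).1 (play D t) = (toLex (p, false), T ∩ remaining (play D t)) := by
            rw [hDi]
            simp only [targetStrategy, if_pos hT, if_neg hlow]
          have hwin : winner (fun k => ((D k).1 (play D t)).1) = i := by
            by_contra hne
            apply hsame
            have hw := winner_eq_of_le (x := fun k => ((b k).1 (play D t)).1)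
              (y := fun k => ((D k).1 (play D t)).1) (i := i)
              (fun j hj => by simp only [hDj j hj]) (by
                simp only [hactD]; exact not_le.1 hlow) hne
            simp only [nextRound, hw, hDj _ hne]
          have hround : nextRound D (play D t) =
              ⟨i, toLex (p, false), T ∩ remaining (play D t)⟩ := by
            simp only [nextRound, hwin, hactD]
          refine ⟨?_, ?_⟩
          · rw [hrem, hround, not_nonempty_iff_eq_empty]
            ext j
            simp only [mem_inter, mem_sdiff, notMem_empty, iff_false]
            tauto
          · obtain ⟨h1, h2⟩ := hpre t ht' hb
            have hsub : T ∩ remaining (play D t) ⊆ wonItems (play D (t + 1)) i := by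
              intro j hj
              rw [e1, hround]
              simp only [wonItems, mem_filter, mem_univ, true_and, List.mem_append]
              exact ⟨_, Or.inr (List.mem_singleton.2 rfl), rfl, hj⟩
            have h3 := hv.2 hsub
            have h4 := hg _ (inter_subset_left (s₁ := T) (s₂ := remaining (play D t)))
            have h5 : totalPayment (play D (t + 1)) i = totalPayment (play b t) i +
                p * (T ∩ remaining (play D t)).card := by
              rw [e1, totalPayment_append, totalPayment_singleton, hround, he]
              simp [Bid.price]
            have h6 : (T.card : ℝ) = (T \ remaining (play b t)).card +
                (T ∩ remaining (play D t)).card := by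
              rw [he]; exact_mod_cast (card_sdiff_add_card_inter T _).symm
            rw [h5]
            rw [h6] at h4
            nlinarith
      · right
        have hB : G ≤ v (wonItems (play D t) i) - totalPayment (play D t) i := by
          rcases ih ht' with ⟨he, hb⟩ | h
          · exact hdone t ht' he hb hT
          · exact h.2
        -- Once `T` is gone, further wins are free and by monotonicity cannot hurt.
        refine ⟨fun hne => hT (hne.mono ?_), hB.trans (sub_le_sub ?_ ?_)⟩
        · rw [hrem]; exact inter_subset_inter_left sdiff_subset
        · rw [e1]; exact hv.2 (wonItems_subset_append _ _ i)
        · rw [e1, totalPayment_append, totalPayment_singleton]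
          split_ifs with hw
          · have hz : (nextRound D (play D t)).bid.price = 0 := by
              have : (nextRound D (play D t)).bid = ((D i).1 (play D t)).1 := by
                change winner (fun k => ((D k).1 (play D t)).1) = i at hw
                simp only [nextRound, hw]
              rw [this, hDi]
              simp only [targetStrategy, if_neg hT]
              simp [Bid.price]
            simp [hz]
          · simp
  rcases key m le_rfl with ⟨he, hb⟩ | h
  · refine hdone m le_rfl he hb ?_
    rw [show remaining (play D m) = ∅ from remaining_finalHistory D]
    simp
  · exact h.2

end Histories

/-! ### Optimal welfare and smoothness -/

theorem optWelfare_nonneg {N I : Type*} [Fintype N] {v : N → Finset I → ℝ}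
    (hv : ∀ i S, 0 ≤ v i S) : 0 ≤ optWelfare v :=
  Real.iSup_nonneg fun _ => sum_nonneg fun i _ => hv i _

theorem exists_optWelfare {N I : Type*} [Fintype N] [Finite I] (v : N → Finset I → ℝ) :
    ∃ A : N → Finset I, (∀ i j, i ≠ j → Disjoint (A i) (A j)) ∧ ∑ i, v i (A i) = optWelfare v := by
  have : Nonempty {A : N → Finset I // ∀ i j, i ≠ j → Disjoint (A i) (A j)} :=
    ⟨⟨fun _ => ∅, fun _ _ _ => disjoint_bot_left⟩⟩
  obtain ⟨A, hA⟩ := exists_eq_ciSup_of_finite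
    (f := fun A : {A : N → Finset I // ∀ i j, i ≠ j → Disjoint (A i) (A j)} => ∑ i, v i (A.1 i))
  exact ⟨A.1, A.2, hA⟩

theorem IsSmooth.mono {N I : Type*} [Fintype N] [DecidableEq N] {M : Mechanism N I}
    {V W : Set (Finset I → ℝ)} {lam lam' mu : ℝ} (h : IsSmooth M W lam mu) (hVW : V ⊆ W)
    (hV : ∀ w ∈ V, IsValuation w) (hlam : lam' ≤ lam) : IsSmooth M V lam' mu := by
  intro v hv
  obtain ⟨dev, hdev⟩ := h v fun i => hVW (hv i)
  refine ⟨dev, fun b => le_trans ?_ (hdev b)⟩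
  have := mul_le_mul_of_nonneg_right hlam (optWelfare_nonneg fun i => (hV _ (hv i)).1)
  linarith

theorem isSmooth_subadditive (N : Type*) [Fintype N] [LinearOrder N] [Nonempty N] {m : ℕ}
    (hm : 1 ≤ m) :
    IsSmooth (draftAuction N m) (subadditive (Fin m)) (1 / (2 * (harmonic m : ℝ))) 2 := by
  intro v hv
  obtain ⟨A, hA, hopt⟩ := exists_optWelfare v
  choose T hTA p g hg hle using fun i => exists_target hm (hv i) (A i)
  refine ⟨fun i => targetStrategy (T i) (p i), fun b => ?_⟩
  have hH : (0 : ℝ) < harmonic m := zero_lt_one.trans_le (one_le_harmonic hm)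
  have hsum := sum_le_sum fun i (_ : i ∈ univ) =>
    utility_targetStrategy (hv i).1 (T i) (p i) (g i) (hg i) b i
  have hrev := sum_itemRevenue_le (finalHistory b) T fun i j hij =>
    (hA i j hij).mono (hTA i) (hTA j)
  have hwel : 1 / (2 * (harmonic m : ℝ)) * optWelfare v ≤ ∑ i, g i := by
    rw [← hopt, one_div, inv_mul_le_iff₀ (by positivity), mul_sum]
    exact sum_le_sum fun i _ => hle i
  rw [sum_sub_distrib, sum_sub_distrib] at hsum
  refine le_trans ?_ hsum
  change _ - 2 * ∑ i, totalPayment (finalHistory b) i ≤ _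
  linarith

/-- `H_m ≤ 1 + log m`, and `m ≤ 2 (m - 1)` gives `log m ≤ log 2 + log (m - 1)`. -/
theorem harmonic_le_four_mul {m : ℕ} (hm : 2 ≤ m) :
    (harmonic m : ℝ) ≤ 4 * (Real.log ((m : ℝ) - 1) + 1) := by
  have hm' : (2 : ℝ) ≤ m := by exact_mod_cast hm
  have h1 := harmonic_le_one_add_log m
  have h2 : Real.log m ≤ Real.log 2 + Real.log ((m : ℝ) - 1) := by
    rw [← Real.log_mul (by norm_num) (by linarith)]
    exact Real.log_le_log (by linarith) (by linarith)
  have h3 : 0 ≤ Real.log ((m : ℝ) - 1) := Real.log_nonneg (by linarith)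
  have h4 := Real.log_two_lt_d9
  linarith

end DraftAuction

theorem mainTheorem7 {N : Type*} [Fintype N] [LinearOrder N] [Nonempty N] (m : ℕ) (hm : 2 ≤ m) :
    DraftAuction.IsSmooth (DraftAuction.draftAuction N m) (DraftAuction.xos (Fin m))
        (1 / (8 * (Real.log ((m : ℝ) - 1) + 1))) 2 ∧
      DraftAuction.IsSmooth (DraftAuction.draftAuction N m) (DraftAuction.subadditive (Fin m))
        (1 / (8 * (harmonic m : ℝ) * (Real.log ((m : ℝ) - 1) + 1))) 2 := by
  have h := DraftAuction.isSmooth_subadditive N (by omega : 1 ≤ m)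
  have hH : (1 : ℝ) ≤ harmonic m := DraftAuction.one_le_harmonic (by omega)
  have hlog := DraftAuction.harmonic_le_four_mul hm
  have hlam : 1 / (8 * (Real.log ((m : ℝ) - 1) + 1)) ≤ 1 / (2 * (harmonic m : ℝ)) :=
    one_div_le_one_div_of_le (by linarith) (by linarith)
  refine ⟨h.mono (DraftAuction.xos_subset_subadditive _) (fun _ hw => hw.1) hlam,
    h.mono Set.Subset.rfl (fun _ hw => hw.1) (le_trans ?_ hlam)⟩
  refine one_div_le_one_div_of_le (by linarith) ?_
  nlinarith
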